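/- Let $n$ be an odd positive integer and let $f,g,h\in\mathbb{Z}_4[x]$ satisfy $fhg=x^n-1$. For $p\in\mathbb{Z}_4[x]$ let $\tilde p\in\mathbb{Z}_2[x]$ denote its reduction modulo $2$, and let $\langle p\rangle\subseteq\mathbb{Z}_4^n$ be the cyclic code of all vectors $(u_0,\dots,u_{n-1})$ for which the class of $u_0+u_1x+\dots+u_{n-1}x^{n-1}$ lies in the ideal generated by $p$ in $\mathbb{Z}_4[x]/(x^n-1)$. Let $\phi:\mathbb{Z}_4^n\to\mathbb{Z}_2^{2n}$ be the Gray map, $\phi(u)=(\hat u,\ \tilde u+\hat u)$, where $u=\tilde u+2\hat u$ and $\tilde u,\hat u$ have entries in $\{0,1\}$. For $\mathcal{C}\subseteq\mathbb{Z}_4^n$ put $\mathcal{R}(\mathcal{C})=\{v\in\mathbb{Z}_4^n \mid \phi(v)\in\langle\phi(\mathcal{C})\rangle\}$, where $\langle\phi(\mathcal{C})\rangle$ is the $\mathbb{Z}_2$-linear span of $\phi(\mathcal{C})$. For a divisor $p$ of $x^n-1$ in $\mathbb{Z}_2[x]$ let $p\otimes p$ be the divisor of $x^n-1$ in $\mathbb{Z}_2[x]$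 whose roots (in an algebraic closure of $\mathbb{Z}_2$) are exactly the products of two, possibly equal, roots of $p$. The Hensel lift of a divisor $p$ of $x^n-1$ in $\mathbb{Z}_2[x]$ is the monic divisor $P$ of $x^n-1$ in $\mathbb{Z}_4[x]$ with $\tilde P=p$. Then $\gcd(\tilde f,\ \tilde g\otimes\tilde g)$ has exactly one Hensel lift $r$, the polynomial $r$ divides $f$ in $\mathbb{Z}_4[x]$, and the code $\mathcal{C}=\langle fh+2f\rangle$ satisfies $$\mathcal{R}(\mathcal{C})=\Big\langle fh+2\,\frac{f}{r}\Big\rangle .$$ -/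

import Mathlib

open Polynomial

open scoped Pointwise

noncomputable section

open scoped Classical in
/-- The polynomial `p ⊗ p` over `ℤ₂`: the squarefree polynomial whose roots, in an algebraic closure
of `ℤ₂`, are the products `x * y` of two (possibly equal) roots of `p`. It is the product of the
distinct minimal polynomials over `ℤ₂` of these products; see `tensorSq_dvd` and
`aeval_tensorSq_eq_zero_iff` for its defining properties. -/
def tensorSq (p : (ZMod 2)[X]) : (ZMod 2)[X] :=
  ∏ m ∈ ((p.aroots (AlgebraicClosure (ZMod 2))).toFinset *
      (p.aroots (AlgebraicClosure (ZMod 2))).toFinset).image (minpoly (ZMod 2)), m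

/-- The roots of `p ⊗ p` are exactly the products of two roots of `p`. -/
theorem aeval_tensorSq_eq_zero_iff {p : (ZMod 2)[X]} (hp : p ≠ 0)
    (z : AlgebraicClosure (ZMod 2)) :
    aeval z (tensorSq p) = 0 ↔
      ∃ x y : AlgebraicClosure (ZMod 2), aeval x p = 0 ∧ aeval y p = 0 ∧ z = x * y := by
  classical
  unfold tensorSq
  rw [map_prod, Finset.prod_eq_zero_iff]
  constructor
  · rintro ⟨m, hm, hz⟩
    obtain ⟨w, hw, rfl⟩ := Finset.mem_image.1 hm
    obtain ⟨x, hx, y, hy, rfl⟩ := Finset.mem_mul.1 hw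
    rw [Multiset.mem_toFinset, mem_aroots] at hx hy
    have hmin : minpoly (ZMod 2) (x * y) = minpoly (ZMod 2) z :=
      minpoly.eq_of_irreducible_of_monic
        (minpoly.irreducible (Algebra.IsIntegral.isIntegral _)) hz
        (minpoly.monic (Algebra.IsIntegral.isIntegral _))
    obtain ⟨σ, hσ⟩ := (Normal.minpoly_eq_iff_mem_orbit (AlgebraicClosure (ZMod 2))).1 hmin.symm
    refine ⟨σ x, σ y, ?_, ?_, ?_⟩
    · rw [aeval_algHom_apply σ x p, hx.2, map_zero]
    · rw [aeval_algHom_apply σ y p, hy.2, map_zero]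
    · rw [← map_mul]; exact hσ.symm
  · rintro ⟨x, y, hx, hy, rfl⟩
    refine ⟨minpoly (ZMod 2) (x * y), Finset.mem_image_of_mem _ (Finset.mul_mem_mul ?_ ?_),
      minpoly.aeval _ _⟩
    · rw [Multiset.mem_toFinset, mem_aroots]; exact ⟨hp, hx⟩
    · rw [Multiset.mem_toFinset, mem_aroots]; exact ⟨hp, hy⟩

/-- If `p` divides `x ^ n - 1`, then so does `p ⊗ p`. -/
theorem tensorSq_dvd {n : ℕ} {p : (ZMod 2)[X]} (hp : p ∣ X ^ n - 1) :
    tensorSq p ∣ X ^ n - 1 := by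
  classical
  have hroot : ∀ x : AlgebraicClosure (ZMod 2), aeval x p = 0 → x ^ n = 1 := by
    intro x hx
    obtain ⟨q, hq⟩ := hp
    have : aeval x (X ^ n - 1 : (ZMod 2)[X]) = 0 := by rw [hq, map_mul, hx, zero_mul]
    simpa [sub_eq_zero] using this
  unfold tensorSq
  apply Finset.prod_dvd_of_coprime
  · intro a ha b hb hab
    obtain ⟨v, -, rfl⟩ := Finset.mem_image.1 ha
    obtain ⟨w, -, rfl⟩ := Finset.mem_image.1 hb
    have iv := minpoly.irreducible (Algebra.IsIntegral.isIntegral (R := ZMod 2) v)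
    have iw := minpoly.irreducible (Algebra.IsIntegral.isIntegral (R := ZMod 2) w)
    refine (iv.coprime_iff_not_dvd).2 fun hd => hab ?_
    exact eq_of_monic_of_associated (minpoly.monic (Algebra.IsIntegral.isIntegral _))
      (minpoly.monic (Algebra.IsIntegral.isIntegral _)) (iv.associated_of_dvd iw hd)
  · intro m hm
    obtain ⟨w, hw, rfl⟩ := Finset.mem_image.1 hm
    obtain ⟨x, hx, y, hy, rfl⟩ := Finset.mem_mul.1 hw
    rw [Multiset.mem_toFinset, mem_aroots] at hx hy
    apply minpoly.dvd
    simp [mul_pow, hroot x hx.2, hroot y hy.2]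

/-- The reduction modulo two `ℤ₄[x] → ℤ₂[x]`. -/
def redTwo (p : (ZMod 4)[X]) : (ZMod 2)[X] :=
  p.map (ZMod.castHom (by norm_num : 2 ∣ 4) (ZMod 2))

/-- `P ∈ ℤ₄[x]` is the Hensel lift of the divisor `p` of `x ^ n - 1` over `ℤ₂` (`n` odd): it is monic,
it divides `x ^ n - 1` over `ℤ₄`, and it reduces to `p` modulo two. -/
def IsHenselLift (n : ℕ) (p : (ZMod 2)[X]) (P : (ZMod 4)[X]) : Prop :=
  P.Monic ∧ P ∣ X ^ n - 1 ∧ redTwo P = p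

/-- The identification of `ℤ₄ⁿ` with `ℤ₄[x] / (x ^ n - 1)`,
`(u₀, …, uₙ₋₁) ↦ u₀ + u₁ x + ⋯ + uₙ₋₁ xⁿ⁻¹`. -/
def vecToQuot (n : ℕ) :
    (Fin n → ZMod 4) →ₗ[ZMod 4] ((ZMod 4)[X] ⧸ Ideal.span {(X ^ n - 1 : (ZMod 4)[X])}) where
  toFun u := Ideal.Quotient.mk _ (∑ i : Fin n, C (u i) * X ^ (i : ℕ))
  map_add' u v := by simp [add_mul, Finset.sum_add_distrib]
  map_smul' c u := by
    rw [RingHom.id_apply, ← Ideal.Quotient.mkₐ_eq_mk (ZMod 4), ← map_smul, Finset.smul_sum]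
    simp [smul_eq_C_mul, mul_assoc]

/-- The cyclic code `⟨p⟩` of length `n` over `ℤ₄`: the vectors that correspond to the elements of the
ideal generated by the class of `p` in `ℤ₄[x] / (x ^ n - 1)`. -/
def cyclicCode (n : ℕ) (p : (ZMod 4)[X]) : Submodule (ZMod 4) (Fin n → ZMod 4) :=
  Submodule.comap (vecToQuot n)
    (Submodule.restrictScalars (ZMod 4)
      (Ideal.span {Ideal.Quotient.mk (Ideal.span {(X ^ n - 1 : (ZMod 4)[X])}) p}))

/-- The Gray map `ℤ₄ⁿ → ℤ₂²ⁿ`: writing `u = ũ + 2 û` with `ũ`, `û` having entries in `{0, 1}`, it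
sends `u` to the concatenation of `û` and `ũ + û`. -/
def grayMap {n : ℕ} (u : Fin n → ZMod 4) : Fin n ⊕ Fin n → ZMod 2 :=
  Sum.elim (fun i => (((u i).val / 2 : ℕ) : ZMod 2))
    (fun i => (((u i).val % 2 : ℕ) : ZMod 2) + (((u i).val / 2 : ℕ) : ZMod 2))

/-- `R(C)`: the vectors over `ℤ₄` whose Gray image lies in the binary linear span of the Gray image
of `C`. -/
def rankCode {n : ℕ} (C : Set (Fin n → ZMod 4)) : Set (Fin n → ZMod 4) :=
  {v | grayMap v ∈ Submodule.span (ZMod 2) (grayMap '' C)}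

end

/-! The Gray map fails to be additive only by a carry: φ(u) + φ(v) = φ(u + v + 2uv)
(`grayMap_add_grayMap`), with uv the componentwise product. So passing from C to R(C) adjoins words
2uv, and these depend only on u and v modulo 2. Modulo 2, C is the binary cyclic code ⟨f̃h̃⟩ with
check polynomial g̃; its even words are 2c with c in ⟨f̃⟩. It remains to see that ⟨f̃⟩ and the
products of words of ⟨f̃h̃⟩ together span ⟨q̃⟩, where f = rq.

Over an algebraic closure this is Fourier analysis. Componentwise multiplication becomes convolution
of transforms, so a product of two words can be nonzero only at products of two roots of g̃
(`exists_roots_of_aeval_vecPoly_mul_ne_zero`). No root of q̃ is such a product, which gives one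
inclusion. Conversely, a functional killing ⟨f̃⟩ and all the products has a transform vanishing at
the inverses of the roots of x^n - 1 outside q̃, hence kills ⟨q̃⟩ (`mem_of_dvd_vecPoly`). Oddness of
n makes x^n - 1 separable, which also yields Hensel lifting and the coprimality arguments over ℤ₄.
-/

section CoefficientVectors

variable {R S : Type*} [CommRing R] [CommRing S] {n : ℕ}

/-- The polynomial `u₀ + u₁ x + ⋯ + uₙ₋₁ xⁿ⁻¹` of a vector `u`. -/
noncomputable def vecPoly (u : Fin n → R) : R[X] := ∑ i : Fin n, C (u i) * X ^ (i : ℕ)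

theorem vecPoly_add (u v : Fin n → R) : vecPoly (u + v) = vecPoly u + vecPoly v := by
  simp [vecPoly, add_mul, Finset.sum_add_distrib]

theorem vecPoly_smul (a : R) (u : Fin n → R) : vecPoly (a • u) = C a * vecPoly u := by
  simp [vecPoly, Finset.mul_sum, mul_assoc]

theorem map_vecPoly (φ : R →+* S) (u : Fin n → R) :
    (vecPoly u).map φ = vecPoly (fun i => φ (u i)) := by
  simp [vecPoly, Polynomial.map_sum]

theorem eval_vecPoly (x : R) (u : Fin n → R) :
    (vecPoly u).eval x = ∑ i, u i * x ^ (i : ℕ) := by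
  simp [vecPoly, eval_finsetSum]

theorem vecPoly_coeff_of_degree_lt {p : R[X]} (hp : p.degree < n) :
    vecPoly (fun i : Fin n => p.coeff i) = p := by
  rcases Nat.eq_zero_or_pos n with rfl | hn
  · have : p = 0 := by simpa [degree_lt_iff_coeff_zero, Polynomial.ext_iff] using hp
    simp [this, vecPoly]
  · have hp' : p.natDegree < n := by
      rcases eq_or_ne p 0 with rfl | h0
      · simpa using hn
      · exact (natDegree_lt_iff_degree_lt h0).2 hp
    conv_rhs => rw [p.as_sum_range' n hp']
    rw [vecPoly, Fin.sum_univ_eq_sum_range (fun i => C (p.coeff i) * X ^ i)]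
    simp [C_mul_X_pow_eq_monomial]

theorem degree_vecPoly_lt (u : Fin n → R) : (vecPoly u).degree < n := by
  refine (degree_sum_le _ _).trans_lt ((Finset.sup_lt_iff (WithBot.bot_lt_coe n)).2 fun i _ => ?_)
  exact (degree_C_mul_X_pow_le _ _).trans_lt (WithBot.coe_lt_coe.2 i.2)

end CoefficientVectors

/-! ### Zeros and nonzeros of cyclic codes via the discrete Fourier transform. -/

section Fourier

variable {K : Type*} [Field K] {n : ℕ}

/-- Fourier inversion for the discrete Fourier transform of length `n`. -/
theorem sum_eval_vecPoly_mul_inv_pow {ζ : K} (hζ : IsPrimitiveRoot ζ n) (w : Fin n → K)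
    (i : Fin n) :
    ∑ k ∈ Finset.range n, (vecPoly w).eval (ζ ^ k) * ((ζ ^ k)⁻¹) ^ (i : ℕ) = n * w i := by
  have hn : n ≠ 0 := fun h => by subst h; exact i.elim0
  have h0 : ζ ≠ 0 := hζ.ne_zero hn
  simp_rw [eval_vecPoly, Finset.sum_mul]
  rw [Finset.sum_comm, Finset.sum_eq_single i]
  · rw [Finset.sum_congr rfl (g := fun _ => w i)]
    · simp
    · intro k _
      rw [mul_assoc, ← mul_pow, mul_inv_cancel₀ (pow_ne_zero _ h0), one_pow, mul_one]
  · intro j _ hji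
    have h1 : ζ ^ (j : ℕ) * (ζ ^ (i : ℕ))⁻¹ ≠ 1 := by
      intro h
      rw [mul_inv_eq_one₀ (pow_ne_zero _ h0)] at h
      exact hji (Fin.ext (hζ.pow_inj j.2 i.2 h))
    have h2 := geom_sum_mul (ζ ^ (j : ℕ) * (ζ ^ (i : ℕ))⁻¹) n
    rw [mul_pow, inv_pow, ← pow_mul, ← pow_mul, mul_comm _ n, mul_comm _ n, pow_mul, pow_mul,
      hζ.pow_eq_one, one_pow, one_pow, inv_one, mul_one, sub_self, mul_eq_zero] at h2
    have h3 := h2.resolve_right (sub_ne_zero.2 h1)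
    rw [← mul_zero (w j), ← h3, Finset.mul_sum]
    refine Finset.sum_congr rfl fun k _ => ?_
    rw [mul_pow, inv_pow, inv_pow, ← pow_mul, ← pow_mul, ← pow_mul, ← pow_mul,
      mul_comm k, mul_comm k, mul_assoc]
  · simp

variable {F : Type*} [Field F] [Algebra F K]

theorem aeval_vecPoly (x : K) (u : Fin n → F) :
    aeval x (vecPoly u) = ∑ i, algebraMap F K (u i) * x ^ (i : ℕ) := by
  simp [vecPoly, map_sum]

theorem pow_eq_one_of_aeval_eq_zero {p : F[X]} (hp : p ∣ X ^ n - 1) {x : K}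
    (hx : aeval x p = 0) : x ^ n = 1 := by
  obtain ⟨q, hq⟩ := hp
  have : aeval x (X ^ n - 1 : F[X]) = 0 := by rw [hq, map_mul, hx, zero_mul]
  simpa [sub_eq_zero] using this

theorem aeval_eq_zero_or_of_mul_eq {s g : F[X]} (hsg : s * g = X ^ n - 1) {x : K}
    (hx : x ^ n = 1) : aeval x s = 0 ∨ aeval x g = 0 := by
  rw [← mul_eq_zero, ← map_mul, hsg]
  simp [hx]

theorem aeval_eq_zero_of_dvd {s p : F[X]} (h : s ∣ p) {x : K} (hx : aeval x s = 0) :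
    aeval x p = 0 := by
  obtain ⟨a, rfl⟩ := h
  rw [map_mul, hx, zero_mul]

/-- Parseval's identity: Fourier inversion applied to `w`, then paired with `y`. -/
theorem sum_aeval_vecPoly_mul {ζ : K} (hζ : IsPrimitiveRoot ζ n) (w : Fin n → F) (y : Fin n → K) :
    ∑ k ∈ Finset.range n, aeval (ζ ^ k) (vecPoly w) * ∑ i, y i * ((ζ ^ k)⁻¹) ^ (i : ℕ) =
      n * ∑ i, y i * algebraMap F K (w i) := by
  simp_rw [Finset.mul_sum]
  rw [Finset.sum_comm]
  refine Finset.sum_congr rfl fun i _ => ?_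
  have := sum_eval_vecPoly_mul_inv_pow hζ (fun i => algebraMap F K (w i)) i
  rw [mul_left_comm, ← this, Finset.mul_sum]
  refine Finset.sum_congr rfl fun k _ => ?_
  rw [← map_vecPoly, eval_map_algebraMap]
  ring

/-- The nonzeros of a componentwise product of words of the cyclic code with check polynomial `g`
are products of roots of `g`. -/
theorem exists_roots_of_aeval_vecPoly_mul_ne_zero {ζ : K} (hζ : IsPrimitiveRoot ζ n)
    (hn : (n : K) ≠ 0) {s g : F[X]} (hsg : s * g = X ^ n - 1) {u v : Fin n → F}
    (hu : s ∣ vecPoly u) (hv : s ∣ vecPoly v) {δ : K} (hδ : δ ^ n = 1)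
    (h : aeval δ (vecPoly (u * v)) ≠ 0) :
    ∃ x y : K, aeval x g = 0 ∧ aeval y g = 0 ∧ δ = x * y := by
  by_contra! hcon
  refine h ?_
  rw [← mul_right_inj' hn, mul_zero, aeval_vecPoly]
  -- Parseval turns the transform of `u * v` at `δ` into a convolution: the `k`-th term pairs the
  -- transform of `u` at `ζ ^ k` with that of `v` at `(ζ ^ k)⁻¹ * δ`. Both are nonzero only if both
  -- points are roots of `g`.
  have := sum_aeval_vecPoly_mul hζ u (fun i => algebraMap F K (v i) * δ ^ (i : ℕ))
  rw [Finset.sum_congr rfl (g := fun i : Fin n => algebraMap F K (v i) * δ ^ (i : ℕ) *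
    algebraMap F K (u i)), ← this]
  · refine Finset.sum_eq_zero fun k _ => ?_
    have h1 : (ζ ^ k) ^ n = 1 := by rw [← pow_mul, mul_comm, pow_mul, hζ.pow_eq_one, one_pow]
    have h0 : ζ ^ k ≠ 0 := by
      intro h0
      have : n ≠ 0 := by rintro rfl; simp at hn
      rw [h0, zero_pow this] at h1
      exact zero_ne_one h1
    rcases aeval_eq_zero_or_of_mul_eq hsg h1 with hk | hk
    · rw [aeval_eq_zero_of_dvd hu hk, zero_mul]
    · have h2 : ((ζ ^ k)⁻¹ * δ) ^ n = 1 := by rw [mul_pow, inv_pow, h1, hδ, inv_one, mul_one]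
      rcases aeval_eq_zero_or_of_mul_eq hsg h2 with hd | hd
      · have := aeval_eq_zero_of_dvd hv hd
        rw [aeval_vecPoly] at this
        simp_rw [mul_assoc, ← mul_pow, mul_comm δ]
        rw [this, mul_zero]
      · exact absurd (by rw [mul_inv_cancel_left₀ h0]) (hcon _ _ hk hd)
  · intro i _
    simp only [Pi.mul_apply, map_mul]
    ring

/-- A functional that vanishes on the cyclic code with check polynomial `g` vanishes on the geometric
progressions of the inverse roots of `g`. -/
theorem sum_mul_inv_pow_eq_zero_of_root (hn : n ≠ 0) {s g : F[X]} (hsg : s * g = X ^ n - 1)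
    {y : Fin n → K}
    (hy : ∀ c : Fin n → F, s ∣ vecPoly c → ∑ i, y i * algebraMap F K (c i) = 0)
    {β : K} (hβ : aeval β g = 0) : ∑ i, y i * β⁻¹ ^ (i : ℕ) = 0 := by
  have hβn : β ^ n = 1 := pow_eq_one_of_aeval_eq_zero ⟨s, by rw [mul_comm, hsg]⟩ hβ
  have hβ0 : β ≠ 0 := by
    rintro rfl
    rw [zero_pow hn] at hβn
    exact zero_ne_one hβn
  have hX0 : (X ^ n - 1 : F[X]) ≠ 0 := (monic_X_pow_sub_C (1 : F) hn).ne_zero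
  have hs0 : s ≠ 0 := by rintro rfl; rw [zero_mul] at hsg; exact hX0 hsg.symm
  have hg0 : g ≠ 0 := by rintro rfl; rw [mul_zero] at hsg; exact hX0 hsg.symm
  have hdeg : s.natDegree + g.natDegree = n := by
    rw [← natDegree_mul hs0 hg0, hsg]; exact natDegree_X_pow_sub_C
  obtain ⟨b, hb⟩ : X - C β ∣ g.map (algebraMap F K) := by
    rw [dvd_iff_isRoot, IsRoot, eval_map_algebraMap, hβ]
  have hbdeg : b.natDegree + 1 = g.natDegree := by
    have hb0 : b ≠ 0 := by
      rintro rfl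
      rw [mul_zero, Polynomial.map_eq_zero] at hb
      exact hg0 hb
    have := congrArg natDegree hb
    rw [natDegree_map, natDegree_mul (X_sub_C_ne_zero β) hb0, natDegree_X_sub_C] at this
    omega
  -- With `b = g / (X - β)`, the product `s * b` is `(X ^ n - 1) / (X - β)`, whose coefficients form
  -- a geometric progression of ratio `β⁻¹`. It is a `K`-combination of the shifts `s * X ^ k` with
  -- `k < deg g`, which have degree below `n` and so are codewords without reduction.
  have hgeom : (∑ i ∈ Finset.range n, X ^ i * C β ^ (n - 1 - i)) =
      s.map (algebraMap F K) * b := by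
    refine mul_right_cancel₀ (X_sub_C_ne_zero β) ?_
    rw [(Commute.all _ _).geom_sum₂_mul, ← C_pow, hβn, mul_assoc, mul_comm b, ← hb,
      ← Polynomial.map_mul, hsg]
    simp
  have hshift : ∀ k ∈ Finset.range (b.natDegree + 1),
      ∑ i : Fin n, y i * (s.map (algebraMap F K) * X ^ k).coeff i = 0 := by
    intro k hk
    rw [Finset.mem_range] at hk
    have hd : (s * X ^ k).degree < (n : WithBot ℕ) := by
      rw [degree_mul, degree_X_pow, degree_eq_natDegree hs0]
      exact_mod_cast (by omega : s.natDegree + k < n)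
    have := hy (fun i => (s * X ^ k).coeff i)
      (by rw [vecPoly_coeff_of_degree_lt hd]; exact dvd_mul_right _ _)
    rw [← this]
    refine Finset.sum_congr rfl fun i _ => ?_
    rw [← coeff_map, Polynomial.map_mul, Polynomial.map_pow, map_X]
  have hsum : ∑ i : Fin n, y i * (s.map (algebraMap F K) * b).coeff i = 0 := by
    conv_lhs => rw [b.as_sum_range_C_mul_X_pow]
    simp_rw [Finset.mul_sum, finsetSum_coeff, Finset.mul_sum]
    rw [Finset.sum_comm]
    refine Finset.sum_eq_zero fun k hk => ?_
    rw [← mul_zero (b.coeff k), ← hshift k hk, Finset.mul_sum]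
    refine Finset.sum_congr rfl fun i _ => ?_
    rw [mul_left_comm, coeff_C_mul]
    ring
  have hcoeff : ∀ i : Fin n, (s.map (algebraMap F K) * b).coeff i =
      β ^ (n - 1) * β⁻¹ ^ (i : ℕ) := by
    intro i
    rw [← hgeom, finsetSum_coeff, Finset.sum_eq_single (i : ℕ)]
    · rw [← C_pow, coeff_mul_C, coeff_X_pow_self, one_mul, inv_pow, ← div_eq_mul_inv,
        eq_div_iff (pow_ne_zero _ hβ0), ← pow_add]
      congr 1
      omega
    · intro j _ hj
      rw [← C_pow, coeff_mul_C, coeff_X_pow, if_neg (Ne.symm hj), zero_mul]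
    · intro hi
      exact absurd (Finset.mem_range.2 i.2) hi
  simp_rw [hcoeff, mul_left_comm _ (β ^ (n - 1)), ← Finset.mul_sum] at hsum
  exact (mul_eq_zero.1 hsum).resolve_left (pow_ne_zero _ hβ0)

/-- A linear code that contains a cyclic code and all componentwise products of words of a second one
contains the cyclic code obtained by removing the products of nonzeros from the zeros. -/
theorem mem_of_dvd_vecPoly {ζ : K} (hζ : IsPrimitiveRoot ζ n) (hn : (n : K) ≠ 0)
    {q r s t g : F[X]} (hqt : q * r * t = X ^ n - 1) (hsg : s * g = X ^ n - 1)
    (hr : ∀ z : K, aeval z r = 0 → ∃ x y : K, aeval x g = 0 ∧ aeval y g = 0 ∧ z = x * y)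
    (W : Submodule F (Fin n → F)) (hW : ∀ c, q * r ∣ vecPoly c → c ∈ W)
    (hWmul : ∀ c d, s ∣ vecPoly c → s ∣ vecPoly d → c * d ∈ W)
    {w : Fin n → F} (hw : q ∣ vecPoly w) : w ∈ W := by
  by_contra hwW
  have hn0 : n ≠ 0 := by rintro rfl; simp at hn
  -- Duality: a functional vanishing on `W` but not at `w`; its coordinate vector `y` is read in
  -- `K`.
  obtain ⟨ℓ, hℓw, hℓ⟩ := Submodule.exists_le_ker_of_notMem hwW
  set y : Fin n → K := fun i => algebraMap F K (ℓ (Pi.single i 1)) with hy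
  have hℓy : ∀ c, algebraMap F K (ℓ c) = ∑ i, y i * algebraMap F K (c i) := by
    intro c
    conv_lhs => rw [pi_eq_sum_univ' c]
    simp [hy, map_sum, mul_comm]
  have hzero : ∀ c ∈ W, ∑ i, y i * algebraMap F K (c i) = 0 := by
    intro c hc
    rw [← hℓy, LinearMap.mem_ker.1 (hℓ hc), map_zero]
  refine hℓw ((algebraMap F K).injective ?_)
  rw [map_zero, hℓy, ← mul_right_inj' hn, mul_zero, ← sum_aeval_vecPoly_mul hζ]
  refine Finset.sum_eq_zero fun k _ => ?_
  have h1 : (ζ ^ k) ^ n = 1 := by rw [← pow_mul, mul_comm, pow_mul, hζ.pow_eq_one, one_pow]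
  rcases aeval_eq_zero_or_of_mul_eq (s := q) (g := r * t) (by rw [← hqt, mul_assoc]) h1
    with hk | hk
  · rw [aeval_eq_zero_of_dvd hw hk, zero_mul]
  rw [map_mul, mul_eq_zero] at hk
  refine mul_eq_zero_of_right _ ?_
  rcases hk with hk | hk
  · obtain ⟨a, b, ha, hb, hab⟩ := hr _ hk
    rw [hab]
    simp_rw [mul_inv, mul_pow, ← mul_assoc]
    rw [Finset.sum_congr rfl fun i _ => mul_right_comm (y i) (a⁻¹ ^ (i : ℕ)) (b⁻¹ ^ (i : ℕ))]
    -- The root lemma is used once per factor: first for `a` with weights `y i * b⁻¹ ^ i`, then,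
    -- with `c` frozen, for `b` with weights `y i * c i`.
    refine sum_mul_inv_pow_eq_zero_of_root hn0 hsg (fun c hc => ?_) ha
    rw [Finset.sum_congr rfl fun i _ => mul_right_comm _ _ _]
    refine sum_mul_inv_pow_eq_zero_of_root hn0 hsg (fun d hd => ?_) hb
    rw [← hzero _ (hWmul c d hc hd)]
    simp [mul_assoc]
  · exact sum_mul_inv_pow_eq_zero_of_root hn0 hqt (fun c hc => hzero c (hW c hc)) hk

end Fourier

/-! ### Lifting from ℤ₂[x] to ℤ₄[x]: coprimality and Hensel lifts. -/

section ReductionModTwo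

theorem redTwo_add (p q : (ZMod 4)[X]) : redTwo (p + q) = redTwo p + redTwo q :=
  Polynomial.map_add _

theorem redTwo_sub (p q : (ZMod 4)[X]) : redTwo (p - q) = redTwo p - redTwo q :=
  Polynomial.map_sub _

theorem redTwo_mul (p q : (ZMod 4)[X]) : redTwo (p * q) = redTwo p * redTwo q :=
  Polynomial.map_mul _

theorem redTwo_X_pow_sub_one (n : ℕ) : redTwo (X ^ n - 1) = X ^ n - 1 := by
  simp [redTwo]

theorem redTwo_two_mul (p : (ZMod 4)[X]) : redTwo (2 * p) = 0 := by
  rw [redTwo_mul, show (2 : (ZMod 4)[X]) = C 2 from rfl, redTwo, map_C]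
  have : (ZMod.castHom (by norm_num : 2 ∣ 4) (ZMod 2)) 2 = 0 := by decide
  rw [this, C_0, zero_mul]

theorem redTwo_dvd {p q : (ZMod 4)[X]} (h : p ∣ q) : redTwo p ∣ redTwo q := by
  obtain ⟨a, rfl⟩ := h
  exact ⟨_, redTwo_mul p a⟩

theorem redTwo_surjective : Function.Surjective redTwo :=
  Polynomial.map_surjective _ (ZMod.castHom_surjective _)

theorem exists_eq_two_mul_of_redTwo_eq_zero {p : (ZMod 4)[X]} (h : redTwo p = 0) :
    ∃ e, p = 2 * e := by
  change C 2 ∣ p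
  rw [C_dvd_iff_dvd_coeff]
  intro i
  have := congrArg (coeff · i) h
  simp only [redTwo, coeff_map, coeff_zero] at this
  generalize p.coeff i = a at this ⊢
  revert a
  decide

theorem four_eq_zero_polynomial : (4 : (ZMod 4)[X]) = 0 := by
  rw [show (4 : (ZMod 4)[X]) = C 4 from rfl, show (4 : ZMod 4) = 0 from rfl, C_0]

/-- Polynomials over `ℤ₄` whose reductions modulo two are coprime are coprime. -/
theorem isCoprime_of_redTwo {p q : (ZMod 4)[X]} (h : IsCoprime (redTwo p) (redTwo q)) :
    IsCoprime p q := by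
  obtain ⟨a, b, hab⟩ := h
  obtain ⟨a, rfl⟩ := redTwo_surjective a
  obtain ⟨b, rfl⟩ := redTwo_surjective b
  obtain ⟨e, he⟩ := exists_eq_two_mul_of_redTwo_eq_zero (p := a * p + b * q - 1) (by
    rw [redTwo_sub, redTwo_add, redTwo_mul, redTwo_mul, hab, ← pow_zero X]
    simp [redTwo])
  -- Here `a * p + b * q = 1 + 2 * e`, a unit that is its own inverse because 4 = 0.
  refine ⟨(1 + 2 * e) * a, (1 + 2 * e) * b, ?_⟩
  linear_combination (1 + 2 * e) * he + (e + e ^ 2) * four_eq_zero_polynomial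

variable {n : ℕ}

theorem separable_X_pow_sub_one_zmod_two (hn : Odd n) : (X ^ n - 1 : (ZMod 2)[X]).Separable := by
  rw [X_pow_sub_one_separable_iff, ZMod.natCast_eq_one_iff_odd.2 hn]
  exact one_ne_zero

theorem isCoprime_of_mul_dvd (hn : Odd n) {p q : (ZMod 2)[X]} (h : p * q ∣ X ^ n - 1) :
    IsCoprime p q :=
  ((separable_X_pow_sub_one_zmod_two hn).of_dvd h).isCoprime

theorem monic_of_ne_zero_zmod_two {p : (ZMod 2)[X]} (hp : p ≠ 0) : p.Monic := by
  have h : ∀ a : ZMod 2, a ≠ 0 → a = 1 := by decide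
  exact h _ (leadingCoeff_ne_zero.2 hp)

theorem X_pow_sub_one_zmod_two_ne_zero (hn : Odd n) : (X ^ n - 1 : (ZMod 2)[X]) ≠ 0 :=
  (separable_X_pow_sub_one_zmod_two hn).ne_zero

/-- Hensel lifts are unique. -/
theorem IsHenselLift.unique (hn : Odd n) {p : (ZMod 2)[X]} {P Q : (ZMod 4)[X]}
    (hP : IsHenselLift n p P) (hQ : IsHenselLift n p Q) : P = Q := by
  have key : ∀ {P Q : (ZMod 4)[X]}, IsHenselLift n p P → IsHenselLift n p Q → P ∣ Q := by
    rintro P Q ⟨-, hPd, hPr⟩ ⟨-, ⟨Q', hQ'⟩, hQr⟩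
    have hc : IsCoprime P Q' := by
      refine isCoprime_of_redTwo (isCoprime_of_mul_dvd hn ?_)
      rw [hPr, ← hQr, ← redTwo_mul, ← hQ', redTwo_X_pow_sub_one]
    exact hc.dvd_of_dvd_mul_right (hQ' ▸ hPd)
  obtain ⟨a, ha⟩ := key hP hQ
  have hle : ∀ {P : (ZMod 4)[X]}, IsHenselLift n p P → P.natDegree = p.natDegree := by
    rintro P ⟨hPm, -, rfl⟩
    exact (hPm.natDegree_map _).symm
  exact eq_of_monic_of_dvd_of_natDegree_le hP.1 hQ.1 ⟨a, ha⟩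
    ((hle hQ).trans (hle hP).symm).le |>.symm

/-- Every divisor of `x ^ n - 1` over `ℤ₂`, with `n` odd, has a Hensel lift. -/
theorem exists_isHenselLift (hn : Odd n) {p : (ZMod 2)[X]} (hp : p ∣ X ^ n - 1) :
    ∃ P, IsHenselLift n p P := by
  obtain ⟨t, ht⟩ := hp
  have hp0 : p ≠ 0 := by
    rintro rfl
    exact X_pow_sub_one_zmod_two_ne_zero hn (by rw [ht, zero_mul])
  have hpm := monic_of_ne_zero_zmod_two hp0
  have hlift : ∀ u : (ZMod 2)[X], u ∈ lifts (ZMod.castHom (by norm_num : 2 ∣ 4) (ZMod 2)) :=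
    fun u => redTwo_surjective u
  obtain ⟨P, hPp, hPd, hPm⟩ := lifts_and_degree_eq_and_monic (hlift p) hpm
  obtain ⟨Q, hQ⟩ := redTwo_surjective t
  change redTwo P = p at hPp
  obtain ⟨E, hE⟩ := exists_eq_two_mul_of_redTwo_eq_zero (p := P * Q - (X ^ n - 1)) (by
    rw [redTwo_sub, redTwo_mul, hPp, hQ, redTwo_X_pow_sub_one, ht, sub_self])
  obtain ⟨a, b, hab⟩ := isCoprime_of_mul_dvd (p := p) (q := t) hn (by rw [ht])
  -- One Newton step: `(P + 2u)(Q + 2v) = X ^ n - 1 + 2(E + uQ + vP)`, so the bracket must vanish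
  -- modulo 2. Bézout solves this; reducing `u` modulo `p` keeps `P + 2u` monic, and the quotient is
  -- moved into `v`.
  obtain ⟨u, hu, hud⟩ := exists_degree_eq_of_mem_lifts (hlift ((-redTwo E * b) %ₘ p))
  change redTwo u = _ at hu
  obtain ⟨v, hv⟩ := redTwo_surjective (-redTwo E * a + ((-redTwo E * b) /ₘ p) * t)
  obtain ⟨w, hw⟩ := exists_eq_two_mul_of_redTwo_eq_zero (p := E + u * Q + v * P) (by
    rw [redTwo_add, redTwo_add, redTwo_mul, redTwo_mul, hu, hv, hPp, hQ]
    linear_combination t * modByMonic_add_div (-redTwo E * b) p - redTwo E * hab)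
  refine ⟨P + 2 * u, hPm.add_of_left ?_, ⟨Q + 2 * v, ?_⟩, ?_⟩
  · refine lt_of_le_of_lt ?_ (hud.trans_lt ((degree_modByMonic_lt _ hpm).trans_eq hPd.symm))
    rw [degree_le_iff_coeff_zero]
    intro k hk
    rw [show (2 : (ZMod 4)[X]) = C 2 from rfl, coeff_C_mul, coeff_eq_zero_of_degree_lt hk, mul_zero]
  · linear_combination -hE - 2 * hw - (u * v + w) * four_eq_zero_polynomial
  · rw [redTwo_add, redTwo_two_mul, add_zero, hPp]

end ReductionModTwo

/-! ### Generators of cyclic codes over ℤ₄, and the Gray map. -/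

section CyclicCodes

theorem nontrivial_zmod_four : Nontrivial (ZMod 4) := ⟨0, 1, by decide⟩

variable {n : ℕ}

theorem mem_cyclicCode_iff {p : (ZMod 4)[X]} {u : Fin n → ZMod 4} :
    u ∈ cyclicCode n p ↔ ∃ a b, vecPoly u = p * a + (X ^ n - 1) * b := by
  change Ideal.Quotient.mk _ (vecPoly u) ∈ Ideal.span _ ↔ _
  rw [Ideal.mem_span_singleton]
  constructor
  · rintro ⟨a, ha⟩
    obtain ⟨a, rfl⟩ := Ideal.Quotient.mk_surjective a
    rw [← map_mul, Ideal.Quotient.eq, Ideal.mem_span_singleton] at ha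
    obtain ⟨b, hb⟩ := ha
    exact ⟨a, b, by linear_combination hb⟩
  · rintro ⟨a, b, h⟩
    refine ⟨Ideal.Quotient.mk _ a, ?_⟩
    rw [← map_mul, Ideal.Quotient.eq, Ideal.mem_span_singleton]
    exact ⟨b, by linear_combination h⟩

/-- The code `⟨f h + 2 q⟩` is generated by `f h` and `2 q`. -/
theorem mem_cyclicCode_add_two_mul_iff (hn : Odd n) {f g h q r : (ZMod 4)[X]}
    (hfhg : f * h * g = X ^ n - 1) (hf : f = r * q) {u : Fin n → ZMod 4} :
    u ∈ cyclicCode n (f * h + 2 * q) ↔ ∃ a b, vecPoly u = f * h * a + 2 * q * b := by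
  rw [mem_cyclicCode_iff]
  constructor
  · rintro ⟨a, b, hu⟩
    exact ⟨a + g * b, a, by linear_combination hu - b * hfhg⟩
  · rintro ⟨a, b, hu⟩
    have hc : IsCoprime g (r * h) := by
      refine isCoprime_of_redTwo (isCoprime_of_mul_dvd hn ?_)
      rw [← redTwo_mul, ← redTwo_X_pow_sub_one, ← hfhg, hf]
      exact redTwo_dvd ⟨q, by ring⟩
    obtain ⟨α, β, hαβ⟩ := hc
    -- Modulo `X ^ n - 1`, multiplying the generator by `g` gives `2qg`, and doubling it gives `2fh
    -- = 2q(rh)`; Bézout for `g` and `rh` combines them into `2q`.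
    have h2q : 2 * q = (f * h + 2 * q) * (α * g + 2 * β) - (X ^ n - 1) * α := by
      linear_combination -α * hfhg - 2 * q * hαβ - 2 * β * h * hf - β * q * four_eq_zero_polynomial
    refine ⟨a + (b - a) * (α * g + 2 * β), -((b - a) * α), ?_⟩
    linear_combination hu + (b - a) * h2q

/-- A word over `ℤ₂` whose polynomial is a multiple of `redTwo p`, for `p ∣ x ^ n - 1`, lifts to a word
over `ℤ₄` whose polynomial is a multiple of `p`. -/
theorem exists_lift_vecPoly (hn : Odd n) {p : (ZMod 4)[X]} (hp : p ∣ X ^ n - 1)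
    {c : Fin n → ZMod 2} (hc : redTwo p ∣ vecPoly c) :
    ∃ u : Fin n → ZMod 4, p ∣ vecPoly u ∧
      ∀ i, ZMod.castHom (by norm_num : 2 ∣ 4) (ZMod 2) (u i) = c i := by
  obtain ⟨a, ha⟩ := hc
  obtain ⟨A, rfl⟩ := redTwo_surjective a
  have hn0 : n ≠ 0 := by rintro rfl; simp at hn
  have := nontrivial_zmod_four
  have hm : (X ^ n - 1 : (ZMod 4)[X]).Monic := monic_X_pow_sub_C 1 hn0
  have hm2 : (X ^ n - 1 : (ZMod 2)[X]).Monic := monic_X_pow_sub_C 1 hn0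
  have hd : (X ^ n - 1 : (ZMod 4)[X]).degree = n := degree_X_pow_sub_C hn0.bot_lt 1
  have hd2 : (X ^ n - 1 : (ZMod 2)[X]).degree = n := degree_X_pow_sub_C hn0.bot_lt 1
  set w := (p * A) %ₘ (X ^ n - 1) with hw
  have hwd : w.degree < (n : WithBot ℕ) := hd ▸ degree_modByMonic_lt _ hm
  refine ⟨fun i => w.coeff i, ?_, fun i => ?_⟩
  · rw [vecPoly_coeff_of_degree_lt hwd, hw, modByMonic_eq_sub_mul_div]
    exact dvd_sub (dvd_mul_right _ _) (hp.mul_right _)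
  · rw [← coeff_map]
    change (redTwo w).coeff i = c i
    have : redTwo w = vecPoly c := by
      rw [hw, redTwo, map_modByMonic _ hm]
      -- Reduction modulo 2 commutes with division by a monic polynomial, and `vecPoly c` is already
      -- reduced modulo `X ^ n - 1`.
      change redTwo (p * A) %ₘ redTwo (X ^ n - 1) = _
      rw [redTwo_mul, ← ha, redTwo_X_pow_sub_one, modByMonic_eq_self_iff hm2, hd2]
      exact degree_vecPoly_lt c
    rw [this, vecPoly, finsetSum_coeff, Finset.sum_eq_single i]
    · simp
    · intro j _ hj
      rw [coeff_C_mul, coeff_X_pow, if_neg (fun h => hj (Fin.ext h.symm)), mul_zero]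
    · simp

/-- The carry of `u + v` into the upper bit is the product of the lower bits; adding `2uv` cancels
it. -/
theorem grayMap_add_grayMap (u v : Fin n → ZMod 4) :
    grayMap u + grayMap v = grayMap (u + v + (2 : ZMod 4) • (u * v)) := by
  ext (i | i)
  all_goals
    simp only [grayMap, Pi.add_apply, Pi.smul_apply, Pi.mul_apply, Sum.elim_inl, Sum.elim_inr]
    generalize u i = a
    generalize v i = b
    revert a b
    decide

theorem grayMap_two_smul (u : Fin n → ZMod 4) :
    grayMap ((2 : ZMod 4) • u) =
      Sum.elim (fun i => ZMod.castHom (by norm_num : 2 ∣ 4) (ZMod 2) (u i))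
        (fun i => ZMod.castHom (by norm_num : 2 ∣ 4) (ZMod 2) (u i)) := by
  ext (i | i)
  all_goals
    simp only [grayMap, Pi.smul_apply, Sum.elim_inl, Sum.elim_inr]
    generalize u i = a
    revert a
    decide

theorem grayMap_injective : Function.Injective (grayMap (n := n)) := by
  intro u v h
  ext i
  have h1 := congrFun h (Sum.inl i)
  have h2 := congrFun h (Sum.inr i)
  simp only [grayMap, Sum.elim_inl, Sum.elim_inr] at h1 h2
  generalize u i = a at h1 h2 ⊢
  generalize v i = b at h1 h2 ⊢
  revert a b
  decide

theorem grayMap_zero : grayMap (0 : Fin n → ZMod 4) = 0 := by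
  ext (i | i) <;> simp [grayMap]

/-- An even summand produces no carry, as the correction term is `4uv = 0`. -/
theorem grayMap_add_two_smul (u v : Fin n → ZMod 4) :
    grayMap (u + (2 : ZMod 4) • v) = grayMap u + grayMap ((2 : ZMod 4) • v) := by
  rw [grayMap_add_grayMap]
  congr 1
  ext i
  simp only [Pi.add_apply, Pi.smul_apply, Pi.mul_apply]
  generalize u i = a
  generalize v i = b
  revert a b
  decide

/-- A `ℤ₄`-linear code that contains `C` and all words `2 u v` with `u` and `v` in the code contains
the words whose Gray image lies in the span of the Gray image of `C`. -/
theorem rankCode_subset {C : Set (Fin n → ZMod 4)} {D : Submodule (ZMod 4) (Fin n → ZMod 4)}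
    (hCD : C ⊆ D) (hD : ∀ u ∈ D, ∀ v ∈ D, (2 : ZMod 4) • (u * v) ∈ D) : rankCode C ⊆ D := by
  intro w hw
  have key : ∀ x ∈ Submodule.span (ZMod 2) (grayMap '' C), ∃ v ∈ D, grayMap v = x := by
    intro x hx
    induction hx using Submodule.span_induction with
    | mem x hx =>
      obtain ⟨c, hc, rfl⟩ := hx
      exact ⟨c, hCD hc, rfl⟩
    | zero => exact ⟨0, D.zero_mem, grayMap_zero⟩
    | add x y _ _ hx hy =>
      obtain ⟨u, hu, rfl⟩ := hx
      obtain ⟨v, hv, rfl⟩ := hy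
      exact ⟨_, D.add_mem (D.add_mem hu hv) (hD u hu v hv), (grayMap_add_grayMap u v).symm⟩
    | smul a x _ hx =>
      have ha : a = 0 ∨ a = 1 := by revert a; decide
      rcases ha with rfl | rfl
      · exact ⟨0, D.zero_mem, by rw [grayMap_zero, zero_smul]⟩
      · rwa [one_smul]
  obtain ⟨v, hv, hvw⟩ := key _ hw
  rwa [← grayMap_injective hvw]

/-- The binary words `c` for which `(c, c)` lies in the span of the Gray image of `C`. -/
def grayTorsion (C : Set (Fin n → ZMod 4)) : Submodule (ZMod 2) (Fin n → ZMod 2) where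
  carrier := {c | Sum.elim c c ∈ Submodule.span (ZMod 2) (grayMap '' C)}
  zero_mem' := by
    have h : (Sum.elim 0 0 : Fin n ⊕ Fin n → ZMod 2) = 0 := Sum.elim_zero_zero
    exact (congrArg (· ∈ Submodule.span (ZMod 2) (grayMap '' C)) h).mpr (Submodule.zero_mem _)
  add_mem' {c d} hc hd := by
    have h : Sum.elim (c + d) (c + d) = Sum.elim c c + Sum.elim d d := by ext (i | i) <;> rfl
    exact (congrArg (· ∈ Submodule.span (ZMod 2) (grayMap '' C)) h).mpr
      (Submodule.add_mem _ hc hd)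
  smul_mem' a c hc := by
    have h : Sum.elim (a • c) (a • c) = a • Sum.elim c c := by ext (i | i) <;> rfl
    exact (congrArg (· ∈ Submodule.span (ZMod 2) (grayMap '' C)) h).mpr
      (Submodule.smul_mem _ a hc)

end CyclicCodes

/-! ### Computation of R(C) from the roots of r and q. -/

section RankCode

variable {n : ℕ}

theorem redTwo_vecPoly (u : Fin n → ZMod 4) :
    redTwo (vecPoly u) =
      vecPoly fun i => ZMod.castHom (by norm_num : 2 ∣ 4) (ZMod 2) (u i) :=
  map_vecPoly _ u

theorem vecPoly_two_smul (u : Fin n → ZMod 4) : vecPoly ((2 : ZMod 4) • u) = 2 * vecPoly u :=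
  vecPoly_smul 2 u

theorem redTwo_dvd_vecPoly_of_mem (hn : Odd n) {f g h q r : (ZMod 4)[X]}
    (hfhg : f * h * g = X ^ n - 1) (hf : f = r * q) {u : Fin n → ZMod 4}
    (hu : u ∈ cyclicCode n (f * h + 2 * q)) :
    redTwo (f * h) ∣ vecPoly fun i => ZMod.castHom (by norm_num : 2 ∣ 4) (ZMod 2) (u i) := by
  obtain ⟨a, b, hab⟩ := (mem_cyclicCode_add_two_mul_iff hn hfhg hf).1 hu
  rw [← redTwo_vecPoly, hab, redTwo_add, mul_assoc 2, redTwo_two_mul, add_zero]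
  exact redTwo_dvd (dvd_mul_right _ _)

/-- A separable polynomial divides every polynomial that vanishes on its roots. -/
theorem Polynomial.Separable.dvd_of_aeval_eq_zero {F K : Type*} [Field F] [Field K] [Algebra F K]
    [IsAlgClosed K] {p q : F[X]} (hp : p.Separable)
    (h : ∀ x : K, aeval x p = 0 → aeval x q = 0) : p ∣ q := by
  rcases eq_or_ne q 0 with rfl | hq
  · exact dvd_zero _
  rw [← map_dvd_map' (algebraMap F K)]
  refine (IsAlgClosed.splits _).dvd_of_roots_le_roots
    ((Polynomial.map_ne_zero_iff (algebraMap F K).injective).2 hp.ne_zero) ?_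
  rw [Multiset.le_iff_subset (nodup_roots hp.map)]
  intro x hx
  exact mem_aroots.2 ⟨hq, h x (mem_aroots.1 hx).2⟩

/-- The gcd enters only through `hr` and `hq`: the factorization `f = r * q` sorts the roots of `f`
modulo 2 into those that are products of two roots of `g` and those that are not. -/
theorem rankCode_cyclicCode (hn : Odd n) {f g h q r : (ZMod 4)[X]}
    (hfhg : f * h * g = X ^ n - 1) (hf : f = r * q)
    (hr : ∀ z : AlgebraicClosure (ZMod 2), aeval z (redTwo r) = 0 →
      ∃ x y : AlgebraicClosure (ZMod 2),
        aeval x (redTwo g) = 0 ∧ aeval y (redTwo g) = 0 ∧ z = x * y)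
    (hq : ∀ x y : AlgebraicClosure (ZMod 2), aeval x (redTwo g) = 0 → aeval y (redTwo g) = 0 →
      aeval (x * y) (redTwo q) ≠ 0) :
    rankCode (cyclicCode n (f * h + 2 * f) : Set (Fin n → ZMod 4)) =
      (cyclicCode n (f * h + 2 * q) : Set (Fin n → ZMod 4)) := by
  have hf1 : f = 1 * f := (one_mul f).symm
  have hn2 : (n : ZMod 2) ≠ 0 := by
    rw [ZMod.natCast_eq_one_iff_odd.2 hn]; exact one_ne_zero
  have hnK : (n : AlgebraicClosure (ZMod 2)) ≠ 0 := by
    rw [← map_natCast (algebraMap (ZMod 2) (AlgebraicClosure (ZMod 2)))]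
    exact (_root_.map_ne_zero _).2 hn2
  have : NeZero (n : ZMod 2) := ⟨hn2⟩
  obtain ⟨ζ, hζ⟩ := HasEnoughRootsOfUnity.exists_primitiveRoot (AlgebraicClosure (ZMod 2)) n
  have hsg : redTwo (f * h) * redTwo g = X ^ n - 1 := by
    rw [← redTwo_mul, hfhg, redTwo_X_pow_sub_one]
  have hqdvd : q ∣ X ^ n - 1 := ⟨r * h * g, by rw [← hfhg, hf]; ring⟩
  have hfdvd : f ∣ X ^ n - 1 := ⟨h * g, by rw [← hfhg]; ring⟩
  have hqdvd2 : redTwo q ∣ X ^ n - 1 := redTwo_X_pow_sub_one n ▸ redTwo_dvd hqdvd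
  apply Set.Subset.antisymm
  · refine rankCode_subset (fun u hu => ?_) (fun u hu v hv => ?_)
    · rw [SetLike.mem_coe, mem_cyclicCode_add_two_mul_iff hn hfhg hf1] at hu
      rw [SetLike.mem_coe, mem_cyclicCode_add_two_mul_iff hn hfhg hf]
      obtain ⟨a, b, hab⟩ := hu
      exact ⟨a, r * b, by linear_combination hab + 2 * b * hf⟩
    · have hdvd : redTwo q ∣ redTwo (vecPoly (u * v)) := by
        rw [redTwo_vecPoly]
        refine (((separable_X_pow_sub_one_zmod_two hn).of_dvd hqdvd2)).dvd_of_aeval_eq_zero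
          (K := AlgebraicClosure (ZMod 2)) fun δ hδ => ?_
        by_contra hne
        simp only [Pi.mul_apply, map_mul] at hne
        obtain ⟨x, y, hx, hy, rfl⟩ := exists_roots_of_aeval_vecPoly_mul_ne_zero hζ hnK hsg
          (redTwo_dvd_vecPoly_of_mem hn hfhg hf hu) (redTwo_dvd_vecPoly_of_mem hn hfhg hf hv)
          (pow_eq_one_of_aeval_eq_zero hqdvd2 hδ) hne
        exact hq x y hx hy hδ
      obtain ⟨b, hb⟩ := hdvd
      obtain ⟨b, rfl⟩ := redTwo_surjective b
      obtain ⟨e, he⟩ := exists_eq_two_mul_of_redTwo_eq_zero (p := vecPoly (u * v) - q * b) (by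
        rw [redTwo_sub, hb, redTwo_mul, sub_self])
      rw [mem_cyclicCode_add_two_mul_iff hn hfhg hf, vecPoly_two_smul]
      exact ⟨0, b, by linear_combination 2 * he + e * four_eq_zero_polynomial⟩
  · intro u hu
    rw [SetLike.mem_coe, mem_cyclicCode_add_two_mul_iff hn hfhg hf] at hu
    obtain ⟨a, b, hab⟩ := hu
    have hmemC : ∀ {v : Fin n → ZMod 4} (a b : (ZMod 4)[X]), vecPoly v = f * h * a + 2 * f * b →
        grayMap v ∈ Submodule.span (ZMod 2)
          (grayMap '' (cyclicCode n (f * h + 2 * f) : Set (Fin n → ZMod 4))) := fun a b hv =>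
      Submodule.subset_span
        ⟨_, (mem_cyclicCode_add_two_mul_iff hn hfhg hf1).2 ⟨a, b, hv⟩, rfl⟩
    have hn0 : n ≠ 0 := by rintro rfl; simp at hn
    have := nontrivial_zmod_four
    have hm : (X ^ n - 1 : (ZMod 4)[X]).Monic := monic_X_pow_sub_C 1 hn0
    have hwd : ((q * b) %ₘ (X ^ n - 1)).degree < (n : WithBot ℕ) :=
      (degree_modByMonic_lt _ hm).trans_eq (degree_X_pow_sub_C hn0.bot_lt 1)
    set w : Fin n → ZMod 4 := fun i => ((q * b) %ₘ (X ^ n - 1)).coeff i with hw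
    have hwp : vecPoly w = q * b - (X ^ n - 1) * ((q * b) /ₘ (X ^ n - 1)) := by
      rw [hw, vecPoly_coeff_of_degree_lt hwd, modByMonic_eq_sub_mul_div]
    -- Since `4w = 0`, adding `2w` twice changes nothing. As `w` represents `q * b`, the first
    -- addition cancels the `2qb` part of `u` and leaves a word of `⟨fh⟩`; only the Gray image of
    -- `2w` remains to be treated.
    have hu' : u = (u + (2 : ZMod 4) • w) + (2 : ZMod 4) • w := by
      ext i
      simp only [Pi.add_apply, Pi.smul_apply]
      generalize u i = x
      generalize w i = y
      revert x y
      decide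
    change grayMap u ∈ Submodule.span (ZMod 2)
      (grayMap '' (cyclicCode n (f * h + 2 * f) : Set (Fin n → ZMod 4)))
    rw [hu', grayMap_add_two_smul]
    refine Submodule.add_mem _ (hmemC (a - 2 * g * ((q * b) /ₘ (X ^ n - 1))) 0 ?_) ?_
    · rw [vecPoly_add, vecPoly_two_smul, hwp, hab, ← hfhg]
      linear_combination q * b * four_eq_zero_polynomial
    rw [grayMap_two_smul]
    change _ ∈ grayTorsion (cyclicCode n (f * h + 2 * f) : Set (Fin n → ZMod 4))
    refine mem_of_dvd_vecPoly (q := redTwo q) (r := redTwo r) (t := redTwo (h * g)) hζ hnK ?_ hsg hr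
      _ (fun c hc => ?_) (fun c d hc hd => ?_) ?_
    · rw [← redTwo_mul, ← redTwo_mul, mul_comm q r, ← hf, ← mul_assoc, hfhg, redTwo_X_pow_sub_one]
    · rw [← redTwo_mul, mul_comm q r, ← hf] at hc
      obtain ⟨v, ⟨b, hv⟩, hvc⟩ := exists_lift_vecPoly hn hfdvd hc
      have := hmemC (v := (2 : ZMod 4) • v) 0 b (by rw [vecPoly_two_smul, hv]; ring)
      rw [grayMap_two_smul, funext hvc] at this
      exact this
    · obtain ⟨v, ⟨b, hv⟩, hvc⟩ := exists_lift_vecPoly hn ⟨g, hfhg.symm⟩ hc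
      obtain ⟨v', ⟨b', hv'⟩, hvd⟩ := exists_lift_vecPoly hn ⟨g, hfhg.symm⟩ hd
      -- `φ(v + v') + φ(v) + φ(v') = φ(2vv')` puts the doubled product of `c` and `d` in the span.
      have hsum := Submodule.add_mem _ (Submodule.add_mem _
        (hmemC (v := v + v') (b + b') 0 (by rw [vecPoly_add, hv, hv']; ring))
        (hmemC b 0 (by rw [hv]; ring))) (hmemC b' 0 (by rw [hv']; ring))
      have hself : ∀ x : Fin n ⊕ Fin n → ZMod 2, x + x = 0 := fun x =>
        funext fun i => CharTwo.add_self_eq_zero (x i)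
      rw [add_assoc, grayMap_add_grayMap v v', grayMap_add_two_smul, ← add_assoc,
        hself, zero_add, grayMap_two_smul] at hsum
      simp only [Pi.mul_apply, map_mul, hvc, hvd] at hsum
      exact hsum
    · rw [← redTwo_vecPoly, hwp]
      exact redTwo_dvd (dvd_sub (dvd_mul_right _ _) (hqdvd.mul_right _))

end RankCode

/-! ### Assembly: the Hensel lift of the gcd divides f, and its roots have the required properties.
-/

open scoped Classical in
theorem mainTheorem10 (n : ℕ) (hn : Odd n) (f g h : (ZMod 4)[X])
    (hfhg : f * h * g = X ^ n - 1) :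
    (∃! r : (ZMod 4)[X],
      IsHenselLift n (EuclideanDomain.gcd (redTwo f) (tensorSq (redTwo g))) r) ∧
    ∀ r : (ZMod 4)[X],
      IsHenselLift n (EuclideanDomain.gcd (redTwo f) (tensorSq (redTwo g))) r →
      ∃ q : (ZMod 4)[X], f = r * q ∧
        rankCode (cyclicCode n (f * h + 2 * f) : Set (Fin n → ZMod 4)) =
          (cyclicCode n (f * h + 2 * q) : Set (Fin n → ZMod 4)) := by
  have hred : redTwo f * redTwo h * redTwo g = X ^ n - 1 := by
    rw [← redTwo_mul, ← redTwo_mul, hfhg, redTwo_X_pow_sub_one]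
  have hX0 := X_pow_sub_one_zmod_two_ne_zero hn
  have hg0 : redTwo g ≠ 0 := by
    intro h0
    rw [h0, mul_zero] at hred
    exact hX0 hred.symm
  have hgcdf := EuclideanDomain.gcd_dvd_left (redTwo f) (tensorSq (redTwo g))
  have hgcdt := EuclideanDomain.gcd_dvd_right (redTwo f) (tensorSq (redTwo g))
  have hfX : redTwo f ∣ X ^ n - 1 := ⟨redTwo h * redTwo g, by rw [← hred]; ring⟩
  obtain ⟨r₀, hr₀⟩ := exists_isHenselLift hn (hgcdf.trans hfX)
  refine ⟨⟨r₀, hr₀, fun r hr => hr.unique hn hr₀⟩, fun r hr => ?_⟩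
  obtain ⟨-, hrX, hrr⟩ := hr
  -- Divisibility `r ∣ f` passes from ℤ₂ to ℤ₄ because `r` divides `f * (h * g)` and is coprime to
  -- the second factor.
  have hc : IsCoprime r (h * g) := by
    refine isCoprime_of_redTwo (isCoprime_of_mul_dvd hn ?_)
    rw [hrr, redTwo_mul, ← hred, mul_assoc]
    exact mul_dvd_mul_right hgcdf _
  obtain ⟨q, hq⟩ : r ∣ f := hc.dvd_of_dvd_mul_right (by rwa [← mul_assoc, hfhg])
  refine ⟨q, hq, rankCode_cyclicCode hn hfhg hq (fun z hz => ?_) (fun x y hx hy hxy => ?_)⟩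
  · rw [hrr] at hz
    exact (aeval_tensorSq_eq_zero_iff hg0 z).1 (aeval_eq_zero_of_dvd hgcdt hz)
  · have hq2 : redTwo f = redTwo r * redTwo q := by rw [← redTwo_mul, ← hq]
    -- A product of roots of `g` that is a root of `q` would be a common root of `f` and the tensor
    -- square, hence of their gcd `r`; but `r` and `q` are coprime modulo 2.
    have hz : aeval (x * y) (redTwo r) = 0 := by
      rw [hrr, EuclideanDomain.gcd_eq_gcd_ab, map_add, map_mul, map_mul, hq2, map_mul, hxy,
        (aeval_tensorSq_eq_zero_iff hg0 (x * y)).2 ⟨x, y, hx, hy, rfl⟩]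
      ring
    obtain ⟨a, b, hab⟩ : IsCoprime (redTwo r) (redTwo q) :=
      isCoprime_of_mul_dvd hn (hq2 ▸ hfX)
    have := congrArg (aeval (x * y)) hab
    rw [map_add, map_mul, map_mul, hz, hxy, mul_zero, mul_zero, add_zero, map_one] at this
    exact zero_ne_one this
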